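/- Let $\mathbb{A}$ be a semi-abelian category (a category with a zero object and binary coproducts that is Barr exact and protomodular) satisfying the *Smith is Huq* condition: two internal equivalence relations on an object have trivial Smith commutator if and only if their normalisations (the associated normal subobjects) have trivial Huq commutator. For objects $L$, $M$ let $L\flat M$ be the kernel of $\binom{1_L}{0}\colon L+M\to L$, with inclusion $\kappa_{L,M}$ into $L+M$. An internal $L$-action on $M$ is an algebra structure $\xi\colon L\flat M\to M$ for the monad $L\flat(-)$; the semidirect product $M\rtimes_\xi L$ is the coequaliser of $i_M\circ\xi$ and $\kappa_{L,M}\colon L\flat M\rightrightarrows L+M$. The trivial action $\tau^L_M$ is $\binom{0}{1_M}\circ\kappa_{L,M}$, and the conjugation action $\chi_M\colon M\flat M\to M$ is $\binom{1_M}{1_M}\circ\kappa_{M,M}$. An $L$-crossed module is a pair $(\partial\colon M\to L,\xi)$ with $\xi$ an internal $L$-action on $M$ such that $\xi\circ(\partial\flat 1_M)=\chi_M$ and $\partial\circ\xi=\chi_L\circ(1_L\flat\partial)$. A morphism $(\partial\colon M\to L,\xi)\to(\partial'\colon M'\to L',\xi')$ in the category $\mathbf{XMod}(\mathbb{A})$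 of all crossed modules is a pair $(f\colon M\to M',\,l\colon L\to L')$ with $\partial'\circ f=l\circ\partial$ and $\xi'\circ(l\flat f)=f\circ\xi$. For an $L$-crossed module $(\partial\colon M\to L,\xi)$, let $[L,M]\le M\rtimes_\xi L$ be the Higgins commutator, that is, the image of the composite of the kernel $L\diamond M\to L+M$ of the canonical morphism $L+M\to L\times M$ with the quotient morphism $L+M\to M\rtimes_\xi L$; it is contained in $M$. Let $\mathbf{Ab}(\mathbb{A})$ be the full subcategory of $\mathbb{A}$ of those objects that admit an internal abelian group structure, regarded as a full subcategory of $\mathbf{XMod}(\mathbb{A})$ through $A\mapsto(0\colon A\to 0,\tau^0_A)$. Then for every object $L$ of $\mathbb{A}$ and every $L$-crossed module $(\partial\colon M\to L,\xi)$, the quotient $M/[L,M]$ is an abelian object, and the quotient morphism $M\to M/[L,M]$ (together with $L\to 0$) is the reflection of $(\partial\colon M\to L,\xi)$ in $\mathbf{Ab}(\mathbb{A})$. Moreover, the following are equivalent: 1. $(\partial\colon M\to L,\xi)$ is perfect in the ad-hoc sense: $[L,M]=M$ as subobjects of $M\rtimes_\xi L$; 2. $(\partial\colon M\to L,\xi)$,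 seen as an object of $\mathbf{XMod}(\mathbb{A})$, is perfect with respect to $\mathbf{Ab}(\mathbb{A})$: its reflection in $\mathbf{Ab}(\mathbb{A})$ is the zero object. -/

import Mathlib

open CategoryTheory Limits ZeroObject

universe v u

-- Make `A ⟶ B` elaborate to the morphisms of a category directly, not through reflexive quivers.
attribute [local instance 2000] CategoryTheory.CategoryStruct.toQuiver

attribute [local simp] prod.lift_fst prod.lift_snd prod.lift_fst_assoc prod.lift_snd_assoc
  coprod.inl_desc coprod.inr_desc coprod.inl_desc_assoc coprod.inr_desc_assoc
  pullback.lift_fst pullback.lift_snd pullback.lift_fst_assoc pullback.lift_snd_assoc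
  kernel.lift_ι kernel.lift_ι_assoc

noncomputable section

/-! ### Semi-abelian categories -/

/-- A semi-abelian category: it has a zero object and binary coproducts, it is Barr exact (regular,
and every internal equivalence relation is a kernel pair), and it is protomodular; in the presence
of a zero object the latter means that the split short five lemma holds. -/
class SemiAbelian (C : Type u) [Category.{v} C] [HasZeroMorphisms C] : Prop
    extends Regular C, HasZeroObject C, HasBinaryCoproducts C where
  isKernelPair_of_equivalenceRelation : ∀ {R X : C} (r₁ r₂ : R ⟶ X), EquivalenceRelation r₁ r₂ →
    ∃ (Y : C) (q : X ⟶ Y), IsKernelPair q r₁ r₂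
  splitShortFive : ∀ {A A' B : C} (p : A ⟶ B) (s : B ⟶ A) (p' : A' ⟶ B) (s' : B ⟶ A') (a : A ⟶ A')
    (_ : s ≫ p = 𝟙 B) (_ : s' ≫ p' = 𝟙 B) (_ : s ≫ a = s') (w : p ≫ 𝟙 B = a ≫ p'),
    IsIso (kernel.map p p' a (𝟙 B) w) → IsIso a

namespace SemiAbelian

variable {C : Type u} [Category.{v} C] [HasZeroMorphisms C] [SemiAbelian C]

/-! Semi-abelian categories have coequalisers; this is what makes semidirect products and quotients
available. -/

lemma isIso_of_factors {A B D E : C} (f : A ⟶ D) (s : D ⟶ A) (hs : s ≫ f = 𝟙 D)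
    (g : B ⟶ D) (t : D ⟶ B) (ht : t ≫ g = 𝟙 D) (m : E ⟶ pullback f g) [Mono m]
    (a : A ⟶ E) (ha : a ≫ m = pullback.lift (𝟙 A) (f ≫ t) (by simp [ht]))
    (b : B ⟶ E) (hb : b ≫ m = pullback.lift (g ≫ s) (𝟙 B) (by simp [hs])) : IsIso m := by
  refine splitShortFive (m ≫ pullback.fst f g) a (pullback.fst f g)
    (pullback.lift (𝟙 A) (f ≫ t) (by simp [ht])) m ?_ (by simp) ha (by simp) ?_
  · rw [← Category.assoc, ha]; simp
  · have w : kernel.ι (pullback.fst f g) ≫ pullback.snd f g ≫ g = 0 := by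
      rw [← pullback.condition, kernel.condition_assoc, zero_comp]
    have h1 : (kernel.ι (pullback.fst f g) ≫ pullback.snd f g ≫ b) ≫ m =
        kernel.ι (pullback.fst f g) := by
      rw [Category.assoc, Category.assoc, hb]
      apply pullback.hom_ext
      · simp only [Category.assoc, pullback.lift_fst, kernel.condition]
        rw [reassoc_of% w, zero_comp]
      · simp
    refine ⟨kernel.lift _ (kernel.ι (pullback.fst f g) ≫ pullback.snd f g ≫ b) ?_, ?_, ?_⟩
    · rw [← Category.assoc, h1, kernel.condition]
    · rw [← cancel_mono (kernel.ι _), ← cancel_mono m]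
      simp only [Category.assoc, kernel.lift_ι_assoc, Category.id_comp]
      simp only [Category.assoc] at h1
      have h2 : kernel.ι (m ≫ pullback.fst f g) ≫ m = kernel.lift (pullback.fst f g)
          (kernel.ι (m ≫ pullback.fst f g) ≫ m) (by rw [Category.assoc, kernel.condition]) ≫
          kernel.ι (pullback.fst f g) := by simp
      rw [reassoc_of% h2, h1, ← h2]
    · rw [← cancel_mono (kernel.ι _)]
      simp only [Category.assoc, kernel.lift_ι, Category.id_comp]
      simpa using h1

lemma difunctional {R X : C} {r₁ r₂ : R ⟶ X} (hR : ReflexiveRelation r₁ r₂)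
    {T : C} (a b c : T ⟶ R) (h₂ : a ≫ r₂ = b ≫ r₂) (h₁ : b ≫ r₁ = c ≫ r₁) :
    ∃ d : T ⟶ R, d ≫ r₁ = a ≫ r₁ ∧ d ≫ r₂ = c ≫ r₂ := by
  have : Mono (prod.lift r₁ r₂) := ⟨fun x y h => hR.right_cancellation x y
    (by simpa using h =≫ prod.fst) (by simpa using h =≫ prod.snd)⟩
  let f := pullback.snd r₂ r₂
  let g := pullback.fst r₁ r₁
  let s : R ⟶ pullback r₂ r₂ := pullback.lift (𝟙 R) (𝟙 R) rfl
  let t : R ⟶ pullback r₁ r₁ := pullback.lift (𝟙 R) (𝟙 R) rfl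
  let e : pullback f g ⟶ X ⨯ X := prod.lift (pullback.fst f g ≫ pullback.fst r₂ r₂ ≫ r₁)
    (pullback.snd f g ≫ pullback.snd r₁ r₁ ≫ r₂)
  let m : pullback e (prod.lift r₁ r₂) ⟶ pullback f g := pullback.fst _ _
  have : IsIso m := by
    refine isIso_of_factors f s (by simp [f, s]) g t (by simp [g, t]) m
      (pullback.lift (pullback.lift (𝟙 _) (f ≫ t) (by simp [g, t])) (pullback.fst r₂ r₂) ?_) ?_
      (pullback.lift (pullback.lift (g ≫ s) (𝟙 _) (by simp [f, s])) (pullback.snd r₁ r₁) ?_) ?_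
    · ext <;> simp [e, f, t, pullback.condition]
    · simp [m]
    · ext <;> simp [e, g, s, pullback.condition]
    · simp [m]
  let x : T ⟶ pullback f g := pullback.lift (pullback.lift a b h₂) (pullback.lift b c h₁)
    (by simp [f, g])
  have h : (x ≫ inv m ≫ pullback.snd _ _) ≫ prod.lift r₁ r₂ = x ≫ e := by
    rw [Category.assoc, Category.assoc, ← pullback.condition]
    simp [m]
  refine ⟨x ≫ inv m ≫ pullback.snd _ _, ?_, ?_⟩
  · have := h =≫ prod.fst
    simp only [Category.assoc, prod.lift_fst] at this ⊢
    rw [this]; simp [e, x]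
  · have := h =≫ prod.snd
    simp only [Category.assoc, prod.lift_snd] at this ⊢
    rw [this]; simp [e, x]

lemma equivalenceRelation_of_reflexive {R X : C} {r₁ r₂ : R ⟶ X} (hR : ReflexiveRelation r₁ r₂) :
    Nonempty (EquivalenceRelation r₁ r₂) := by
  obtain ⟨s, hs₁, hs₂⟩ := difunctional hR (r₂ ≫ hR.r) (𝟙 R) (r₁ ≫ hR.r) (by simp) (by simp)
  obtain ⟨t, ht₁, ht₂⟩ := difunctional hR (pullback.fst r₂ r₁)
    ((pullback.fst r₂ r₁ ≫ r₂) ≫ hR.r) (pullback.snd r₂ r₁) (by simp)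
    (by simp [pullback.condition])
  exact ⟨{ hR with
    s := s
    symmetry₁ := by simpa using hs₁
    symmetry₂ := by simpa using hs₂
    c := PullbackCone.mk (pullback.fst r₂ r₁) (pullback.snd r₂ r₁) pullback.condition
    isLimit := pullbackIsPullback r₂ r₁
    t := t
    transitivity₁ := ht₁
    transitivity₂ := ht₂ }⟩

instance : HasCoequalizers C := by
  suffices ∀ {A B : C} (f g : A ⟶ B), HasCoequalizer f g from
    hasCoequalizers_of_hasColimit_parallelPair C
  intro A B f g
  let h : A ⨿ B ⟶ B ⨯ B := coprod.desc (prod.lift f g) (prod.lift (𝟙 B) (𝟙 B))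
  let F := Regular.strongEpiMonoFactorisation h
  have hF : F.e ≫ F.m = h := F.fac
  let r₁ := F.m ≫ prod.fst
  let r₂ := F.m ≫ prod.snd
  have h₁ : F.e ≫ r₁ = coprod.desc f (𝟙 B) := by
    rw [← Category.assoc, hF]; ext <;> simp [h]
  have h₂ : F.e ≫ r₂ = coprod.desc g (𝟙 B) := by
    rw [← Category.assoc, hF]; ext <;> simp [h]
  have hR : ReflexiveRelation r₁ r₂ :=
    { right_cancellation := fun Y x y hx hy => by
        rw [← cancel_mono F.m]
        ext
        · simpa [r₁] using hx
        · simpa [r₂] using hy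
      r := coprod.inr ≫ F.e
      reflexivity₁ := by rw [Category.assoc, h₁, coprod.inr_desc]
      reflexivity₂ := by rw [Category.assoc, h₂, coprod.inr_desc] }
  obtain ⟨hE⟩ := equivalenceRelation_of_reflexive hR
  obtain ⟨Y, q, hq⟩ := isKernelPair_of_equivalenceRelation r₁ r₂ hE
  have : HasCoequalizer r₁ r₂ := Regular.hasCoequalizer_of_isKernelPair hq
  have : Epi F.e := inferInstance
  have hw : f ≫ coequalizer.π r₁ r₂ = g ≫ coequalizer.π r₁ r₂ := by
    have := coprod.inl ≫= F.e ≫= coequalizer.condition r₁ r₂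
    rw [reassoc_of% h₁, reassoc_of% h₂] at this
    simpa using this
  have hd : ∀ c : Cofork f g, r₁ ≫ c.π = r₂ ≫ c.π := fun c => by
    rw [← cancel_epi F.e, reassoc_of% h₁, reassoc_of% h₂]
    ext <;> simp [c.condition]
  refine ⟨⟨⟨Cofork.ofπ (coequalizer.π r₁ r₂) hw, Cofork.IsColimit.mk _
    (fun c => coequalizer.desc c.π (hd c)) (fun c => coequalizer.π_desc _ _) ?_⟩⟩⟩
  intro c l hl
  exact coequalizer.hom_ext (f := r₁) (g := r₂) (hl.trans (coequalizer.π_desc _ _).symm)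

end SemiAbelian

namespace SemiAbelian

variable {C : Type u} [Category.{v} C] [HasZeroMorphisms C] [SemiAbelian C]

/-! ### The condition (SH) -/

/-- Two equivalence relations `R` and `S` on `X` have trivial Smith (Pedicchio) commutator: there is
a connector `p : R ×_X S ⟶ X`, `p (x, y, y) = x` and `p (x, x, y) = y`. -/
def SmithCommute {R S X : C} {r₁ r₂ : R ⟶ X} {s₁ s₂ : S ⟶ X}
    (hR : EquivalenceRelation r₁ r₂) (hS : EquivalenceRelation s₁ s₂) : Prop :=
  ∃ p : pullback r₂ s₁ ⟶ X,
    pullback.lift (𝟙 R) (r₂ ≫ hS.r) (by simp) ≫ p = r₁ ∧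
    pullback.lift (s₁ ≫ hR.r) (𝟙 S) (by simp) ≫ p = s₂

/-- Two morphisms `m`, `n` into `X` have trivial Huq commutator: they cooperate. -/
def HuqCommute {M N X : C} (m : M ⟶ X) (n : N ⟶ X) : Prop :=
  ∃ φ : M ⨯ N ⟶ X, prod.lift (𝟙 M) 0 ≫ φ = m ∧ prod.lift 0 (𝟙 N) ≫ φ = n

/-- The normal subobject associated with an equivalence relation: the elements related to zero. -/
def normalisation {R X : C} (r₁ r₂ : R ⟶ X) : kernel r₁ ⟶ X := kernel.ι r₁ ≫ r₂

variable (C) in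
/-- The *Smith is Huq* condition (SH). -/
def SmithIsHuq : Prop :=
  ∀ {R S X : C} {r₁ r₂ : R ⟶ X} {s₁ s₂ : S ⟶ X}
    (hR : EquivalenceRelation r₁ r₂) (hS : EquivalenceRelation s₁ s₂),
    SmithCommute hR hS ↔ HuqCommute (normalisation r₁ r₂) (normalisation s₁ s₂)

/-! ### Higgins commutators -/

/-- The canonical morphism from the coproduct to the product. -/
def coprodToProd (K L : C) : K ⨿ L ⟶ K ⨯ L :=
  coprod.desc (prod.lift (𝟙 K) 0) (prod.lift 0 (𝟙 L))

/-- The co-smash product `K ⋄ L`. -/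
def cosmash (K L : C) : C := kernel (coprodToProd K L)

/-- The inclusion of `K ⋄ L` in `K + L`. -/
def cosmashι (K L : C) : cosmash K L ⟶ K ⨿ L := kernel.ι (coprodToProd K L)

/-- The Higgins commutator `[K, L] ≤ X` of a cospan `k : K ⟶ X`, `l : L ⟶ X`. -/
def higgins {K L X : C} (k : K ⟶ X) (l : L ⟶ X) : Subobject X :=
  imageSubobject (cosmashι K L ≫ coprod.desc k l)

/-! ### Internal actions -/

/-- `L ♭ M`, the kernel of `(1, 0) : L + M ⟶ L`. -/
def flat (L M : C) : C := kernel (coprod.desc (𝟙 L) (0 : M ⟶ L))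

/-- The inclusion of `L ♭ M` in `L + M`. -/
def flatι (L M : C) : flat L M ⟶ L ⨿ M := kernel.ι _

instance (L M : C) : Mono (flatι L M) := inferInstanceAs (Mono (kernel.ι _))

lemma flatι_comp (L M : C) : flatι L M ≫ coprod.desc (𝟙 L) (0 : M ⟶ L) = 0 :=
  kernel.condition _

/-- Functoriality of `♭` in both variables. -/
def flatMap {L L' M M' : C} (l : L ⟶ L') (f : M ⟶ M') : flat L M ⟶ flat L' M' :=
  kernel.map _ _ (coprod.map l f) l (by ext <;> simp)

lemma flatMap_ι {L L' M M' : C} (l : L ⟶ L') (f : M ⟶ M') :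
    flatMap l f ≫ flatι L' M' = flatι L M ≫ coprod.map l f :=
  kernel.lift_ι _ _ _

/-- The unit `M ⟶ L ♭ M` of the monad `L ♭ (-)`. -/
def flatUnit (L M : C) : M ⟶ flat L M :=
  kernel.lift _ (coprod.inr : M ⟶ L ⨿ M) (by simp)

lemma flatUnit_ι (L M : C) : flatUnit L M ≫ flatι L M = coprod.inr :=
  kernel.lift_ι _ _ _

/-- The multiplication `L ♭ (L ♭ M) ⟶ L ♭ M` of the monad `L ♭ (-)`. -/
def flatMul (L M : C) : flat L (flat L M) ⟶ flat L M :=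
  kernel.lift _ (flatι L (flat L M) ≫ coprod.desc coprod.inl (flatι L M)) (by
    have : coprod.desc coprod.inl (flatι L M) ≫ coprod.desc (𝟙 L) (0 : M ⟶ L) =
        coprod.desc (𝟙 L) 0 := by
      ext <;> simp [flatι_comp]
    rw [Category.assoc, this, flatι_comp])

lemma flatMul_ι (L M : C) :
    flatMul L M ≫ flatι L M = flatι L (flat L M) ≫ coprod.desc coprod.inl (flatι L M) :=
  kernel.lift_ι _ _ _

/-- An internal `L`-action on `M`: an algebra structure on `M` for the monad `L ♭ (-)`. -/
structure InternalAction (L M : C) where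
  act : flat L M ⟶ M
  unit_act : flatUnit L M ≫ act = 𝟙 M
  mul_act : flatMul L M ≫ act = flatMap (𝟙 L) act ≫ act

/-- The trivial action of `L` on `M`. -/
def trivialAction (L M : C) : InternalAction L M where
  act := flatι L M ≫ coprod.desc 0 (𝟙 M)
  unit_act := by rw [← Category.assoc, flatUnit_ι, coprod.inr_desc]
  mul_act := by
    rw [← Category.assoc, flatMul_ι, ← Category.assoc, flatMap_ι, Category.assoc, Category.assoc]
    congr 1
    ext <;> simp

lemma trivialAction_natural {L L' M M' : C} (l : L ⟶ L') (f : M ⟶ M') :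
    flatMap l f ≫ (trivialAction L' M').act = (trivialAction L M).act ≫ f := by
  simp only [trivialAction]
  rw [← Category.assoc, flatMap_ι, Category.assoc, Category.assoc]
  congr 1
  ext <;> simp

/-- The conjugation action `χ : L ♭ L ⟶ L` of an object on itself. -/
def conj (L : C) : flat L L ⟶ L := flatι L L ≫ coprod.desc (𝟙 L) (𝟙 L)

namespace InternalAction

variable {L M : C} (ξ : InternalAction L M)

/-- The semidirect product `M ⋊ L` of an action. -/
def semidirect : C := coequalizer (ξ.act ≫ (coprod.inr : M ⟶ L ⨿ M)) (flatι L M)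

/-- The quotient morphism `L + M ⟶ M ⋊ L`. -/
def quot : L ⨿ M ⟶ ξ.semidirect := coequalizer.π _ _

/-- The section `L ⟶ M ⋊ L`. -/
def inL : L ⟶ ξ.semidirect := coprod.inl ≫ ξ.quot

/-- The kernel part `M ⟶ M ⋊ L`. -/
def inM : M ⟶ ξ.semidirect := coprod.inr ≫ ξ.quot

/-- The commutator `[L, M]`, the Higgins commutator of `L` and `M` in `M ⋊ L`. -/
def commutator : Subobject ξ.semidirect := higgins ξ.inL ξ.inM

/-- The inclusion `[L, M] ⟶ M` of the commutator, computed by intersecting `[L, M]` with `M` in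
`M ⋊ L` (the commutator `[L, M]` is contained in `M`, so the intersection is `[L, M]` itself). -/
def commutatorToM : (((Subobject.pullback ξ.inM).obj ξ.commutator : Subobject M) : C) ⟶ M :=
  ((Subobject.pullback ξ.inM).obj ξ.commutator).arrow

/-- The quotient `M / [L, M]`. -/
def coinvariants : C := cokernel ξ.commutatorToM

/-- The quotient morphism `M ⟶ M / [L, M]`. -/
def toCoinvariants : M ⟶ ξ.coinvariants := cokernel.π ξ.commutatorToM

end InternalAction

/-! ### Internal crossed modules -/

/-- An `L`-crossed module `(∂ : M ⟶ L, ξ)`. -/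
structure CrossedModuleOver (L : C) where
  M : C
  bdry : M ⟶ L
  action : InternalAction L M
  peiffer : flatMap bdry (𝟙 M) ≫ action.act = conj M
  precrossed : flatMap (𝟙 L) bdry ≫ conj L = action.act ≫ bdry

/-- An `L`-crossed module is perfect (in the ad-hoc sense) when `[L, M] = M` as subobjects of
`M ⋊ L`. -/
def CrossedModuleOver.IsPerfect {L : C} (X : CrossedModuleOver L) : Prop :=
  X.action.commutator = imageSubobject X.action.inM

variable (C) in
/-- A crossed module: an `L`-crossed module for some object `L`. -/
structure XMod where
  base : C
  toOver : CrossedModuleOver base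

/-- An `L`-crossed module seen as an object of `XMod`. -/
def CrossedModuleOver.toXMod {L : C} (X : CrossedModuleOver L) : XMod C := ⟨L, X⟩

/-- Morphisms of crossed modules: pairs `(f, l)` compatible with the structure morphisms and the
actions. -/
@[ext]
structure XMod.Hom (X Y : XMod C) where
  f : X.toOver.M ⟶ Y.toOver.M
  l : X.base ⟶ Y.base
  comm : f ≫ Y.toOver.bdry = X.toOver.bdry ≫ l
  equivariant : flatMap l f ≫ Y.toOver.action.act = X.toOver.action.act ≫ f

lemma flatMap_id (L M : C) : flatMap (𝟙 L) (𝟙 M) = 𝟙 (flat L M) := by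
  rw [← cancel_mono (flatι L M), flatMap_ι]; simp

lemma flatMap_comp {L L' L'' M M' M'' : C} (l : L ⟶ L') (l' : L' ⟶ L'') (f : M ⟶ M')
    (f' : M' ⟶ M'') : flatMap (l ≫ l') (f ≫ f') = flatMap l f ≫ flatMap l' f' := by
  rw [← cancel_mono (flatι L'' M''), flatMap_ι, Category.assoc, flatMap_ι, ← Category.assoc,
    flatMap_ι]
  simp

instance : Category (XMod C) where
  Hom X Y := XMod.Hom X Y
  id X := ⟨𝟙 _, 𝟙 _, by simp, by rw [flatMap_id]; simp⟩
  comp a b := ⟨a.f ≫ b.f, a.l ≫ b.l, by rw [Category.assoc, b.comm, ← Category.assoc, a.comm,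
    Category.assoc], by rw [flatMap_comp, Category.assoc, b.equivariant, ← Category.assoc,
    a.equivariant, Category.assoc]⟩
  id_comp a := by apply XMod.Hom.ext <;> simp
  comp_id a := by apply XMod.Hom.ext <;> simp
  assoc a b c := by apply XMod.Hom.ext <;> simp

/-! ### Abelian objects, as crossed modules -/

/-- An object is abelian when it admits an internal abelian group structure. -/
def IsAbelianObject (A : C) : Prop :=
  letI : CartesianMonoidalCategory C := CartesianMonoidalCategory.ofHasFiniteProducts
  letI : BraidedCategory C := BraidedCategory.ofCartesianMonoidalCategory
  ∃ _ : GrpObj A, IsCommMonObj A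

variable (C) in
/-- The category `Ab` of abelian objects, a full subcategory of `C`. -/
abbrev AbObj := ObjectProperty.FullSubcategory (IsAbelianObject (C := C))

lemma conj_of_isAbelianObject {A : C} (hA : IsAbelianObject A) :
    conj A = flatι A A ≫ coprod.desc 0 (𝟙 A) := by
  let _ : CartesianMonoidalCategory C := CartesianMonoidalCategory.ofHasFiniteProducts
  let _ : BraidedCategory C := BraidedCategory.ofCartesianMonoidalCategory
  obtain ⟨G, -⟩ := hA
  have hz : CartesianMonoidalCategory.toUnit A ≫ MonObj.one = (0 : A ⟶ A) := by
    have : CartesianMonoidalCategory.toUnit A = 0 :=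
      CartesianMonoidalCategory.toUnit_unique _ _
    rw [this, zero_comp]
  have h1 : CartesianMonoidalCategory.lift (𝟙 A) (0 : A ⟶ A) ≫ MonObj.mul = 𝟙 A := by
    rw [← hz]; simp
  have h2 : CartesianMonoidalCategory.lift (0 : A ⟶ A) (𝟙 A) ≫ MonObj.mul = 𝟙 A := by
    rw [← hz]; simp
  let r := coprod.desc (CartesianMonoidalCategory.lift (𝟙 A) (0 : A ⟶ A))
    (CartesianMonoidalCategory.lift (0 : A ⟶ A) (𝟙 A))
  have hr : r ≫ MonObj.mul = coprod.desc (𝟙 A) (𝟙 A) := by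
    ext <;> simp [r, h1, h2]
  have hk : flatι A A ≫ r = CartesianMonoidalCategory.lift (0 : flat A A ⟶ A)
      (flatι A A ≫ coprod.desc 0 (𝟙 A)) := by
    have e1 : r ≫ SemiCartesianMonoidalCategory.fst A A = coprod.desc (𝟙 A) 0 := by
      ext <;> simp [r]
    have e2 : r ≫ SemiCartesianMonoidalCategory.snd A A = coprod.desc 0 (𝟙 A) := by
      ext <;> simp [r]
    apply CartesianMonoidalCategory.hom_ext
    · rw [Category.assoc, e1, flatι_comp]; simp
    · rw [Category.assoc, e2]; simp
  have h3 : CartesianMonoidalCategory.lift (0 : flat A A ⟶ A)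
      (flatι A A ≫ coprod.desc 0 (𝟙 A)) = (flatι A A ≫ coprod.desc 0 (𝟙 A)) ≫
        CartesianMonoidalCategory.lift (0 : A ⟶ A) (𝟙 A) := by
    simp
  rw [conj, ← hr, ← Category.assoc, hk, h3, Category.assoc, h2, Category.comp_id]

/-- The crossed module `(0 : A ⟶ 0, τ)` of an abelian object `A`, with `τ` the trivial action. -/
def abToXMod (A : C) (hA : IsAbelianObject A) : XMod C where
  base := 0
  toOver :=
    { M := A
      bdry := 0
      action := trivialAction 0 A
      peiffer := by
        rw [trivialAction_natural, conj_of_isAbelianObject hA]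
        exact Category.comp_id _
      precrossed := (isZero_zero C).eq_of_tgt _ _ }

variable (C) in
/-- The inclusion `A ↦ (0 : A ⟶ 0, τ)` of `Ab` in `XMod`. -/
def abInclusion : AbObj C ⥤ XMod C where
  obj A := abToXMod A.obj A.property
  map {A B} g :=
    { f := g.hom
      l := 𝟙 _
      comm := (isZero_zero C).eq_of_tgt _ _
      equivariant := trivialAction_natural _ _ }
  map_id A := by apply XMod.Hom.ext <;> rfl
  map_comp a b := by
    apply XMod.Hom.ext
    · rfl
    · exact (isZero_zero C).eq_of_tgt _ _

instance : (abInclusion C).Full where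
  map_surjective {A B} g :=
    ⟨ObjectProperty.homMk g.f, by
      apply XMod.Hom.ext
      · rfl
      · exact (isZero_zero C).eq_of_tgt _ _⟩

instance : (abInclusion C).Faithful where
  map_injective {A B} g h e := by
    ext
    exact congrArg XMod.Hom.f e

end SemiAbelian

/-- An object `X` is perfect with respect to a full subcategory (given by its inclusion functor
`H`) when its reflection, i.e. the target of a universal morphism `X ⟶ H Y`, is zero. -/
def IsPerfectWithRespectTo {𝒳 : Type*} {𝒞 : Type*} [Category* 𝒳] [Category* 𝒞] (H : 𝒳 ⥤ 𝒞)
    (X : 𝒞) : Prop :=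
  ∃ (Y : 𝒳) (η : X ⟶ H.obj Y), Nonempty (StructuredArrow.mk η).IsUniversal ∧ IsZero Y

end

/-! Write `τ` for the trivial action. A morphism from `(∂ : M ⟶ L, ξ)` to `(0 : A ⟶ 0, τ)` amounts
to a `g : M ⟶ A` with `ξ ≫ g = τ ≫ g`. Now `τ : L ♭ M ⟶ M` is split by the unit, `ξ` has the same
section, and `L ⋄ M` is the kernel of `τ`. By protomodularity the section and the kernel are jointly
epic, so the condition says that `g` vanishes on `ξ(L ⋄ M)`, which is `[L, M]` (`act_comp_eq_iff`,
`commutatorToM_comp_eq_zero_iff`). Hence `M / [L, M]` has the universal property. It is abelian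
because the Peiffer identity makes conjugation in `M` trivial on the quotient, so that the quotient
morphism commutes with itself.

If `[L, M] = M` the quotient clearly vanishes. Conversely, a subobject with zero cokernel need not
be everything, so more is needed: the reflexive pair `(τ, ξ)` has zero coequaliser, and by exactness
together with the Mal'tsev property every element of `M` is locally `ξ(t)` with `τ(t) = 0`, hence in
`[L, M]` (`commutator_eq_of_isZero`). -/

noncomputable section

namespace SemiAbelian

variable {C : Type u} [Category.{v} C] [HasZeroMorphisms C] [SemiAbelian C]

/-! ### Consequences of protomodularity -/

/-- The section and the kernel of a split epimorphism are jointly extremally epic. -/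
lemma isIso_of_factors_section_kernel {A B E : C} (p : A ⟶ B) (s : B ⟶ A) (hs : s ≫ p = 𝟙 B)
    (m : E ⟶ A) [Mono m] (t : B ⟶ E) (ht : t ≫ m = s)
    (k : kernel p ⟶ E) (hk : k ≫ m = kernel.ι p) : IsIso m := by
  refine splitShortFive (m ≫ p) t p s m (by rw [reassoc_of% ht, hs]) hs ht (by simp) ?_
  refine ⟨kernel.lift _ k (by rw [reassoc_of% hk, kernel.condition]), ?_, ?_⟩
  · rw [← cancel_mono (kernel.ι _), ← cancel_mono m]
    simp [hk]
  · rw [← cancel_mono (kernel.ι _)]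
    simp [hk]

/-- The section and the kernel of a split epimorphism are jointly epic. -/
lemma hom_ext_section_kernel {A B Z : C} (p : A ⟶ B) (s : B ⟶ A) (hs : s ≫ p = 𝟙 B)
    {f g : A ⟶ Z} (h₁ : s ≫ f = s ≫ g) (h₂ : kernel.ι p ≫ f = kernel.ι p ≫ g) : f = g := by
  have := isIso_of_factors_section_kernel p s hs (equalizer.ι f g) (equalizer.lift s h₁)
    (equalizer.lift_ι _ _) (equalizer.lift _ h₂) (equalizer.lift_ι _ _)
  rw [← cancel_epi (equalizer.ι f g), equalizer.condition]

/-- A regular epimorphism is a cokernel of its kernel. -/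
lemma exists_desc_of_isRegularEpi {A B Z : C} (f : A ⟶ B) [IsRegularEpi f] (g : A ⟶ Z)
    (h : kernel.ι f ≫ g = 0) : ∃ g' : B ⟶ Z, f ≫ g' = g := by
  refine ⟨_, IsRegularEpi.fac f g ?_⟩
  -- The first projection of the kernel pair is split by the diagonal, and its kernel is carried
  -- into the kernel of `f` by the second projection; equality is tested on these two.
  have : pullback.fst f f ≫ g = pullback.snd f f ≫ g := by
    refine hom_ext_section_kernel (pullback.fst f f) (pullback.lift (𝟙 A) (𝟙 A) rfl) (by simp)
      (by simp) ?_
    have e : kernel.ι (pullback.fst f f) ≫ pullback.snd f f =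
        kernel.lift f (kernel.ι (pullback.fst f f) ≫ pullback.snd f f) (by
          rw [Category.assoc, ← pullback.condition, kernel.condition_assoc, zero_comp]) ≫
          kernel.ι f := by simp
    rw [kernel.condition_assoc, zero_comp, reassoc_of% e, h, comp_zero]
  simpa using pullback.lift _ _ (IsRegularEpi.w f) ≫= this

lemma kernelι_prodFst (M N : C) :
    kernel.ι (prod.fst : M ⨯ N ⟶ M) =
      (kernel.ι (prod.fst : M ⨯ N ⟶ M) ≫ prod.snd) ≫ prod.lift 0 (𝟙 N) := by
  ext <;> simp

/-- The inclusions of the factors in a product are jointly extremally epic. -/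
lemma isIso_of_factors_prod {M N E : C} (m : E ⟶ M ⨯ N) [Mono m] (a : M ⟶ E)
    (ha : a ≫ m = prod.lift (𝟙 M) 0) (b : N ⟶ E) (hb : b ≫ m = prod.lift 0 (𝟙 N)) : IsIso m :=
  isIso_of_factors_section_kernel prod.fst (prod.lift (𝟙 M) 0) (by simp) m a ha
    ((kernel.ι (prod.fst : M ⨯ N ⟶ M) ≫ prod.snd) ≫ b)
    (by rw [Category.assoc, hb, ← kernelι_prodFst])

/-- The inclusions of the factors in a product are jointly epic. -/
lemma prod_hom_ext {M N Z : C} {f g : M ⨯ N ⟶ Z}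
    (h₁ : prod.lift (𝟙 M) 0 ≫ f = prod.lift (𝟙 M) 0 ≫ g)
    (h₂ : prod.lift 0 (𝟙 N) ≫ f = prod.lift 0 (𝟙 N) ≫ g) : f = g :=
  hom_ext_section_kernel prod.fst (prod.lift (𝟙 M) 0) (by simp) h₁
    (by rw [kernelι_prodFst]; simp only [Category.assoc, h₂])

/-- The image contains both factors, hence is the whole product. -/
lemma isRegularEpi_coprodToProd (M N : C) : IsRegularEpi (coprodToProd M N) := by
  let F := Regular.strongEpiMonoFactorisation (coprodToProd M N)
  have hF : F.e ≫ F.m = coprodToProd M N := F.fac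
  have : IsIso F.m := isIso_of_factors_prod F.m (coprod.inl ≫ F.e)
    (by rw [Category.assoc, hF]; simp [coprodToProd]) (coprod.inr ≫ F.e)
    (by rw [Category.assoc, hF]; simp [coprodToProd])
  have : StrongEpi (coprodToProd M N) := by
    rw [← hF]; exact strongEpi_comp _ _
  infer_instance

/-- The kernel pair of the coequaliser of a reflexive pair is the image of that pair. -/
lemma exists_cover_of_comp_coequalizer_eq {A X T : C} (d₀ d₁ : A ⟶ X) (s : X ⟶ A)
    (h₀ : s ≫ d₀ = 𝟙 X) (h₁ : s ≫ d₁ = 𝟙 X) (x y : T ⟶ X)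
    (h : x ≫ coequalizer.π d₀ d₁ = y ≫ coequalizer.π d₀ d₁) :
    ∃ (T' : C) (p : T' ⟶ T) (t : T' ⟶ A), IsRegularEpi p ∧ t ≫ d₀ = p ≫ x ∧ t ≫ d₁ = p ≫ y := by
  obtain ⟨I, e, m, he, hm, hF⟩ : ∃ (I : C) (e : A ⟶ I) (m : I ⟶ X ⨯ X),
      IsRegularEpi e ∧ Mono m ∧ e ≫ m = prod.lift d₀ d₁ :=
    let F := Regular.strongEpiMonoFactorisation (prod.lift d₀ d₁)
    ⟨F.I, F.e, F.m, inferInstance, inferInstance, F.fac⟩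
  have e₀ : e ≫ m ≫ prod.fst = d₀ := by rw [reassoc_of% hF, prod.lift_fst]
  have e₁ : e ≫ m ≫ prod.snd = d₁ := by rw [reassoc_of% hF, prod.lift_snd]
  have hR : ReflexiveRelation (m ≫ prod.fst) (m ≫ prod.snd) :=
    { right_cancellation := fun Y a b ha hb => by
        rw [← cancel_mono m]
        ext
        · simpa using ha
        · simpa using hb
      r := s ≫ e
      reflexivity₁ := by rw [Category.assoc, e₀, h₀]
      reflexivity₂ := by rw [Category.assoc, e₁, h₁] }
  -- The image `I` is a reflexive relation, hence an equivalence relation, hence the kernel pair of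
  -- some `q`. Since `q` factors through the coequaliser, `(x, y)` lands in `I`; pulling back `e`
  -- gives the cover.
  obtain ⟨hE⟩ := equivalenceRelation_of_reflexive hR
  obtain ⟨Y, q, hq⟩ := isKernelPair_of_equivalenceRelation _ _ hE
  have hd : d₀ ≫ q = d₁ ≫ q := by
    rw [← e₀, ← e₁]; simpa using e ≫= hq.w
  have hxy : x ≫ q = y ≫ q := by
    have := h =≫ coequalizer.desc q hd
    simpa only [Category.assoc, coequalizer.π_desc] using this
  refine ⟨pullback e (hq.lift x y hxy), pullback.snd _ _, pullback.fst _ _, inferInstance, ?_, ?_⟩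
  · rw [← e₀, pullback.condition_assoc, hq.lift_fst]
  · rw [← e₁, pullback.condition_assoc, hq.lift_snd]

/-! ### Abelian objects -/

/-- An object with a unital binary operation is abelian. -/
lemma isAbelianObject_of_unital {A : C} (μ : A ⨯ A ⟶ A) (h₁ : prod.lift (𝟙 A) 0 ≫ μ = 𝟙 A)
    (h₂ : prod.lift 0 (𝟙 A) ≫ μ = 𝟙 A) : IsAbelianObject A := by
  have e₁ {T : C} (f : T ⟶ A) : prod.lift f 0 ≫ μ = f := by
    rw [show prod.lift f (0 : T ⟶ A) = f ≫ prod.lift (𝟙 A) 0 by ext <;> simp, Category.assoc,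
      h₁, Category.comp_id]
  have e₂ {T : C} (f : T ⟶ A) : prod.lift 0 f ≫ μ = f := by
    rw [show prod.lift (0 : T ⟶ A) f = f ≫ prod.lift 0 (𝟙 A) by ext <;> simp, Category.assoc,
      h₂, Category.comp_id]
  have comm : prod.lift prod.snd prod.fst ≫ μ = μ := by
    apply prod_hom_ext
    · rw [← Category.assoc, prod.comp_lift]; simp [h₁, h₂]
    · rw [← Category.assoc, prod.comp_lift]; simp [h₁, h₂]
  have assoc : prod.lift (prod.fst ≫ μ) prod.snd ≫ μ =
      prod.lift (prod.fst ≫ prod.fst) (prod.lift (prod.fst ≫ prod.snd) prod.snd ≫ μ) ≫ μ := by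
    -- On triples `(a, b, 0)` both sides are `μ(a, b)`; on `(0, 0, c)` both are `c`.
    apply prod_hom_ext
    · have : prod.lift prod.fst prod.snd = 𝟙 (A ⨯ A) := by ext <;> simp
      simp only [← Category.assoc, prod.comp_lift]
      simp only [prod.lift_fst, prod.lift_snd, Category.id_comp, e₁, this]
    · simp only [← Category.assoc, prod.comp_lift]
      simp [e₂]
  -- The shear `(x, y) ↦ (x, x + y)` takes the section `(1, 0)` to the diagonal and is the identity
  -- on the kernel of the first projection, so it is invertible. Its inverse sends `(x, 0)` to `(x,
  -- -x)`, which defines `ν`.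
  let θ : A ⨯ A ⟶ A ⨯ A := prod.lift prod.fst μ
  have hθ : IsIso θ := by
    refine splitShortFive prod.fst (prod.lift (𝟙 A) 0) prod.fst (prod.lift (𝟙 A) (𝟙 A)) θ
      (by simp) (by simp) (by ext <;> simp [θ, h₁]) (by simp [θ]) ?_
    have e : kernel.map prod.fst prod.fst θ (𝟙 A) (by simp [θ]) = 𝟙 _ := by
      rw [← cancel_mono (kernel.ι _), kernel.lift_ι, Category.id_comp]
      conv_lhs => rw [kernelι_prodFst]
      conv_rhs => rw [kernelι_prodFst]
      rw [Category.assoc]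
      congr 1
      ext <;> simp [θ, h₂]
    rw [e]
    infer_instance
  let ν : A ⟶ A := prod.lift (𝟙 A) 0 ≫ inv θ ≫ prod.snd
  have hν : prod.lift (𝟙 A) ν ≫ μ = 0 := by
    have : prod.lift (𝟙 A) ν = prod.lift (𝟙 A) 0 ≫ inv θ := by
      ext
      · have : inv θ ≫ prod.fst = prod.fst := by rw [IsIso.inv_comp_eq]; simp [θ]
        simp [this]
      · simp [ν]
    have hm : inv θ ≫ μ = prod.snd := by rw [IsIso.inv_comp_eq]; simp [θ]
    rw [this, Category.assoc, hm, prod.lift_snd]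
  have hν' : prod.lift ν (𝟙 A) ≫ μ = 0 := by
    rw [← hν]
    conv_lhs => rw [← comm]
    rw [← Category.assoc, prod.comp_lift, prod.lift_fst, prod.lift_snd]
  let _ : CartesianMonoidalCategory C := CartesianMonoidalCategory.ofHasFiniteProducts
  let _ : BraidedCategory C := BraidedCategory.ofCartesianMonoidalCategory
  have hL {T : C} (f g : T ⟶ A) : CartesianMonoidalCategory.lift f g ≫
      prod.lift (SemiCartesianMonoidalCategory.fst A A) (SemiCartesianMonoidalCategory.snd A A) =
        prod.lift f g := by
    ext <;> simp
  let _ : GrpObj A :=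
    { one := 0
      mul := prod.lift (SemiCartesianMonoidalCategory.fst A A)
        (SemiCartesianMonoidalCategory.snd A A) ≫ μ
      one_mul := by
        rw [← Category.assoc, prod.comp_lift]
        simp [e₂, CartesianMonoidalCategory.leftUnitor_hom]
      mul_one := by
        rw [← Category.assoc, prod.comp_lift]
        simp [e₁, CartesianMonoidalCategory.rightUnitor_hom]
      mul_assoc := by
        have := prod.lift (prod.lift
          (SemiCartesianMonoidalCategory.fst _ A ≫ SemiCartesianMonoidalCategory.fst A A)
          (SemiCartesianMonoidalCategory.fst _ A ≫ SemiCartesianMonoidalCategory.snd A A))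
          (SemiCartesianMonoidalCategory.snd _ A) ≫= assoc
        simpa [prod.comp_lift_assoc, prod.comp_lift] using this
      inv := ν
      left_inv := by
        rw [reassoc_of% hL, hν', comp_zero]
      right_inv := by
        rw [reassoc_of% hL, hν, comp_zero] }
  refine ⟨inferInstance, ⟨?_⟩⟩
  change (BraidedCategory.braiding A A).hom ≫ prod.lift _ _ ≫ μ = prod.lift _ _ ≫ μ
  rw [← Category.assoc, prod.comp_lift]
  conv_rhs => rw [← comm, ← Category.assoc, prod.comp_lift]
  simp

/-- A morphism on `M ⨯ N` descends along a regular epimorphism `q : M ⟶ Q` as soon as its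
restriction to `M` does. -/
lemma exists_desc_prodMap {M N Q Z : C} (q : M ⟶ Q) [IsRegularEpi q] (φ : M ⨯ N ⟶ Z) (g : Q ⟶ Z)
    (h : prod.lift (𝟙 M) 0 ≫ φ = q ≫ g) :
    ∃ ψ : Q ⨯ N ⟶ Z, prod.lift (𝟙 Q) 0 ≫ ψ = g ∧
      prod.lift 0 (𝟙 N) ≫ ψ = prod.lift 0 (𝟙 N) ≫ φ := by
  have : IsRegularEpi (prod.map q (𝟙 N)) :=
    Regular.regularEpiIsStableUnderBaseChange.of_isPullback
      (IsPullback.of_prod_fst_with_id q N) ‹_›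
  have e₁ : (kernel.ι (prod.map q (𝟙 N)) ≫ prod.fst) ≫ q = 0 := by
    rw [Category.assoc, ← prod.map_fst q (𝟙 N), kernel.condition_assoc, zero_comp]
  have e₂ : kernel.ι (prod.map q (𝟙 N)) ≫ prod.snd = 0 := by
    rw [← Category.comp_id prod.snd, ← prod.map_snd q (𝟙 N), kernel.condition_assoc, zero_comp]
  -- The kernel of `q × 1` lies in the first factor, where `φ` is known to factor through `q`.
  have e : kernel.ι (prod.map q (𝟙 N)) =
      (kernel.ι (prod.map q (𝟙 N)) ≫ prod.fst) ≫ prod.lift (𝟙 M) 0 := by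
    ext <;> simp [e₂]
  obtain ⟨ψ, hψ⟩ := exists_desc_of_isRegularEpi (prod.map q (𝟙 N)) φ
    (by rw [e, Category.assoc, h, ← Category.assoc, e₁, zero_comp])
  refine ⟨ψ, ?_, ?_⟩
  · rw [← cancel_epi q, ← h, ← hψ]
    simp only [← Category.assoc]
    congr 1
    ext <;> simp
  · rw [← hψ, ← Category.assoc]
    congr 1
    ext <;> simp

/-- If `q : M ⟶ Q` is a regular epimorphism which commutes with itself, then `Q` is abelian. -/
lemma isAbelianObject_of_cosmashι_comp {M Q : C} (q : M ⟶ Q) [IsRegularEpi q]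
    (h : cosmashι M M ≫ coprod.desc q q = 0) : IsAbelianObject Q := by
  have := isRegularEpi_coprodToProd M M
  obtain ⟨φ, hφ⟩ := exists_desc_of_isRegularEpi (coprodToProd M M) (coprod.desc q q) h
  have hφ₁ : prod.lift (𝟙 M) 0 ≫ φ = q := by
    simpa [coprodToProd] using coprod.inl ≫= hφ
  have hφ₂ : prod.lift 0 (𝟙 M) ≫ φ = q := by
    simpa [coprodToProd] using coprod.inr ≫= hφ
  -- The first variable descends to `Q`; after exchanging the factors, so does the second.
  obtain ⟨ψ, hψ₁, hψ₂⟩ := exists_desc_prodMap q φ (𝟙 Q) (by rw [hφ₁, Category.comp_id])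
  have e₁ : prod.lift (𝟙 M) 0 ≫ prod.lift prod.snd prod.fst =
      prod.lift (0 : M ⟶ Q) (𝟙 M) := by ext <;> simp
  have e₂ : prod.lift 0 (𝟙 Q) ≫ prod.lift prod.snd prod.fst =
      prod.lift (𝟙 Q) (0 : Q ⟶ M) := by ext <;> simp
  obtain ⟨μ, hμ₁, hμ₂⟩ := exists_desc_prodMap q (prod.lift prod.snd prod.fst ≫ ψ) (𝟙 Q)
    (by rw [reassoc_of% e₁, hψ₂, hφ₂, Category.comp_id])
  exact isAbelianObject_of_unital μ hμ₁ (by rw [hμ₂, reassoc_of% e₂, hψ₁])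

lemma isRegularEpi_factorThruImageSubobject {A B : C} (f : A ⟶ B) :
    IsRegularEpi (factorThruImageSubobject f) := by
  have : StrongEpi (factorThruImageSubobject f) := strongEpi_comp _ _
  infer_instance

/-! ### Semidirect products and coinvariants -/

lemma coprodToProd_fst (L M : C) :
    coprodToProd L M ≫ prod.fst = coprod.desc (𝟙 L) (0 : M ⟶ L) := by
  ext <;> simp [coprodToProd]

lemma coprodToProd_snd (L M : C) :
    coprodToProd L M ≫ prod.snd = coprod.desc (0 : L ⟶ M) (𝟙 M) := by
  ext <;> simp [coprodToProd]

lemma cosmashι_comp (L M : C) : cosmashι L M ≫ coprodToProd L M = 0 :=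
  kernel.condition _

/-- The inclusion of `L ⋄ M` in `L ♭ M`. -/
def cosmashToFlat (L M : C) : cosmash L M ⟶ flat L M :=
  kernel.lift _ (cosmashι L M) (by
    rw [← coprodToProd_fst, reassoc_of% cosmashι_comp, zero_comp])

lemma cosmashToFlat_ι (L M : C) : cosmashToFlat L M ≫ flatι L M = cosmashι L M :=
  kernel.lift_ι _ _ _

lemma cosmashToFlat_trivialAction (L M : C) :
    cosmashToFlat L M ≫ (trivialAction L M).act = 0 := by
  rw [trivialAction, ← Category.assoc, cosmashToFlat_ι, ← coprodToProd_snd,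
    reassoc_of% cosmashι_comp, zero_comp]

/-- `L ⋄ M` is the kernel of the trivial action. -/
lemma exists_comp_cosmashToFlat {L M T : C} (t : T ⟶ flat L M)
    (ht : t ≫ (trivialAction L M).act = 0) : ∃ t', t' ≫ cosmashToFlat L M = t := by
  have h : (t ≫ flatι L M) ≫ coprodToProd L M = 0 := by
    ext
    · rw [Category.assoc, Category.assoc, coprodToProd_fst, flatι_comp, comp_zero, zero_comp]
    · rw [Category.assoc, Category.assoc, coprodToProd_snd, zero_comp]
      exact ht
  obtain ⟨t', ht'⟩ : ∃ t' : T ⟶ cosmash L M, t' ≫ cosmashι L M = t ≫ flatι L M :=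
    ⟨kernel.lift _ _ h, kernel.lift_ι _ _ _⟩
  refine ⟨t', ?_⟩
  rw [← cancel_mono (flatι L M), Category.assoc, cosmashToFlat_ι, ht']

namespace InternalAction

variable {L M : C} (ξ : InternalAction L M)

lemma act_inM : ξ.act ≫ ξ.inM = flatι L M ≫ ξ.quot :=
  (Category.assoc _ _ _).symm.trans (coequalizer.condition _ _)

lemma exists_quot_comp_eq {Z : C} (g : L ⨿ M ⟶ Z) (h : (ξ.act ≫ coprod.inr) ≫ g = flatι L M ≫ g) :
    ∃ d : ξ.semidirect ⟶ Z, ξ.quot ≫ d = g :=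
  ⟨coequalizer.desc g h, coequalizer.π_desc _ _⟩

/-- The object acted upon is a subobject of the semidirect product. -/
instance : Mono ξ.inM := by
  -- The coequaliser is reached by a reflexive pair, whose identifications are described by a single
  -- element of `L + L ♭ M` after passing to a cover.
  let d₀ : L ⨿ flat L M ⟶ L ⨿ M := coprod.desc coprod.inl (flatι L M)
  let d₁ : L ⨿ flat L M ⟶ L ⨿ M := coprod.map (𝟙 L) ξ.act
  have hd : (ξ.act ≫ coprod.inr) ≫ coequalizer.π d₀ d₁ = flatι L M ≫ coequalizer.π d₀ d₁ := by
    simpa [d₀, d₁] using (coprod.inr ≫= coequalizer.condition d₀ d₁).symm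
  refine ⟨fun {T} x y h => ?_⟩
  have h' : (x ≫ coprod.inr) ≫ coequalizer.π d₀ d₁ = (y ≫ coprod.inr) ≫ coequalizer.π d₀ d₁ := by
    obtain ⟨d, hd⟩ := ξ.exists_quot_comp_eq _ hd
    simpa [inM, hd] using h =≫ d
  obtain ⟨T', p, t, hp, h₀, h₁⟩ := exists_cover_of_comp_coequalizer_eq d₀ d₁
    (coprod.map (𝟙 L) (flatUnit L M)) (by ext <;> simp [d₀, flatUnit_ι])
    (by ext <;> simp [d₁, ξ.unit_act]) _ _ h'
  -- The `L`-component of `t` is that of `y`, which is zero, so `t` lies in `L ♭ (L ♭ M)`. There the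
  -- multiplication gives `x` and `1 ♭ ξ` gives `y`, both up to the unit; the algebra laws then
  -- yield `x = y`.
  have ht : t ≫ coprod.desc (𝟙 L) (0 : flat L M ⟶ L) = 0 := by
    have : d₁ ≫ coprod.desc (𝟙 L) (0 : M ⟶ L) = coprod.desc (𝟙 L) 0 := by ext <;> simp [d₁]
    rw [← this, reassoc_of% h₁]; simp
  let t' : T' ⟶ flat L (flat L M) := kernel.lift _ t ht
  have ht' : t' ≫ flatι L (flat L M) = t := kernel.lift_ι _ _ _
  have e₀ : t' ≫ flatMul L M = p ≫ x ≫ flatUnit L M := by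
    rw [← cancel_mono (flatι L M)]
    simp only [Category.assoc, flatMul_ι, flatUnit_ι]
    rw [reassoc_of% ht', h₀]
  have e₁ : t' ≫ flatMap (𝟙 L) ξ.act = p ≫ y ≫ flatUnit L M := by
    rw [← cancel_mono (flatι L M)]
    simp only [Category.assoc, flatMap_ι, flatUnit_ι]
    rw [reassoc_of% ht', h₁]
  have := t' ≫= ξ.mul_act
  rw [reassoc_of% e₀, reassoc_of% e₁, ξ.unit_act, Category.comp_id, Category.comp_id] at this
  exact (cancel_epi p).1 this

lemma cosmashι_desc_inL_inM :
    cosmashι L M ≫ coprod.desc ξ.inL ξ.inM = cosmashToFlat L M ≫ ξ.act ≫ ξ.inM := by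
  have : coprod.desc ξ.inL ξ.inM = ξ.quot := by ext <;> simp [inL, inM]
  rw [this, act_inM, ← cosmashToFlat_ι, Category.assoc]

/-- `[L, M]` is the image of the restriction of the action to `L ⋄ M`. -/
lemma exists_cover_commutator :
    ∃ e : cosmash L M ⟶ (ξ.commutator : C), IsRegularEpi e ∧
      e ≫ ξ.commutator.arrow = cosmashToFlat L M ≫ ξ.act ≫ ξ.inM := by
  refine ⟨factorThruImageSubobject (cosmashι L M ≫ coprod.desc ξ.inL ξ.inM), ?_, ?_⟩
  · exact isRegularEpi_factorThruImageSubobject _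
  · rw [← cosmashι_desc_inL_inM]
    exact imageSubobject_arrow_comp _

lemma exists_comp_commutatorToM {T : C} (x : T ⟶ M) (y : T ⟶ (ξ.commutator : C))
    (h : y ≫ ξ.commutator.arrow = x ≫ ξ.inM) : ∃ u, u ≫ ξ.commutatorToM = x :=
  ⟨(Subobject.isPullback ξ.inM ξ.commutator).lift y x h, IsPullback.lift_snd _ _ _ _⟩

/-- Replaces the subobject `[L, M]` of `M` by its cover `L ⋄ M`, on which the action can be
computed. -/
lemma commutatorToM_comp_eq_zero_iff {Z : C} (g : M ⟶ Z) :
    ξ.commutatorToM ≫ g = 0 ↔ cosmashToFlat L M ≫ ξ.act ≫ g = 0 := by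
  obtain ⟨e, he, hc⟩ := ξ.exists_cover_commutator
  refine ⟨fun h => ?_, fun h => ?_⟩
  · obtain ⟨u, hu⟩ := ξ.exists_comp_commutatorToM (cosmashToFlat L M ≫ ξ.act) e (by simpa using hc)
    rw [← Category.assoc, ← hu, Category.assoc, h, comp_zero]
  · let π := Subobject.pullbackπ ξ.inM ξ.commutator
    have hπ : π ≫ ξ.commutator.arrow = ξ.commutatorToM ≫ ξ.inM :=
      (Subobject.isPullback ξ.inM ξ.commutator).w
    have hp : pullback.snd e π ≫ ξ.commutatorToM =
        pullback.fst e π ≫ cosmashToFlat L M ≫ ξ.act := by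
      rw [← cancel_mono ξ.inM, Category.assoc, ← hπ, ← pullback.condition_assoc, hc]
      simp
    rw [← cancel_epi (pullback.snd e π), reassoc_of% hp, h, comp_zero, comp_zero]

/-- Both actions are retractions of the unit, so they can differ only on the kernel `L ⋄ M` of the
trivial one. -/
lemma act_comp_eq_iff {Z : C} (g : M ⟶ Z) :
    ξ.act ≫ g = (trivialAction L M).act ≫ g ↔ cosmashToFlat L M ≫ ξ.act ≫ g = 0 := by
  refine ⟨fun h => ?_, fun h => ?_⟩
  · rw [h, ← Category.assoc, cosmashToFlat_trivialAction, zero_comp]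
  · refine hom_ext_section_kernel (trivialAction L M).act (flatUnit L M)
      (trivialAction L M).unit_act ?_ ?_
    · rw [← Category.assoc, ← Category.assoc, ξ.unit_act, (trivialAction L M).unit_act]
    · obtain ⟨t, ht⟩ := exists_comp_cosmashToFlat (kernel.ι (trivialAction L M).act)
        (kernel.condition _)
      rw [kernel.condition_assoc, zero_comp, ← ht, Category.assoc, h, comp_zero]

instance : IsRegularEpi ξ.toCoinvariants :=
  inferInstanceAs (IsRegularEpi (coequalizer.π _ _))

lemma act_toCoinvariants :
    ξ.act ≫ ξ.toCoinvariants = (trivialAction L M).act ≫ ξ.toCoinvariants := by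
  rw [act_comp_eq_iff, ← commutatorToM_comp_eq_zero_iff]
  exact cokernel.condition _

/-- If the coinvariants vanish, then `[L, M]` is all of `M`. -/
lemma commutator_eq_of_isZero (h : IsZero ξ.coinvariants) :
    ξ.commutator = imageSubobject ξ.inM := by
  -- This coequaliser kills `[L, M]`, so it factors through the coinvariants, which are zero.
  have hπ : coequalizer.π (trivialAction L M).act ξ.act = 0 := by
    have := (ξ.commutatorToM_comp_eq_zero_iff (coequalizer.π (trivialAction L M).act ξ.act)).2
      ((ξ.act_comp_eq_iff _).1 (coequalizer.condition _ _).symm)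
    rw [← cokernel.π_desc _ _ this]
    exact (congrArg _ (h.eq_of_src (cokernel.desc _ _ this) 0)).trans comp_zero
  -- The zero quotient identifies `0` with `𝟙 M`: over a cover `p`, some `t` has trivial action `0`
  -- and `ξ`-action `p`. So `t` comes from `L ⋄ M`, and `p` factors through `[L, M]` in `M ⋊ L`.
  obtain ⟨T, p, t, hp, h₀, h₁⟩ := exists_cover_of_comp_coequalizer_eq (trivialAction L M).act ξ.act
    (flatUnit L M) (trivialAction L M).unit_act ξ.unit_act 0 (𝟙 M) (by rw [hπ, comp_zero, comp_zero])
  obtain ⟨t', rfl⟩ := exists_comp_cosmashToFlat t (by rw [h₀, comp_zero])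
  obtain ⟨e, -, hc⟩ := ξ.exists_cover_commutator
  refine le_antisymm ?_ ?_
  · refine imageSubobject_le _ (cosmashToFlat L M ≫ ξ.act ≫ factorThruImageSubobject ξ.inM) ?_
    rw [cosmashι_desc_inL_inM]
    simp
  -- A regular epimorphism lifts against the monomorphism `[L, M] ⟶ M ⋊ L`.
  · have sq : CommSq (t' ≫ e) p ξ.commutator.arrow ξ.inM :=
      ⟨by rw [Category.assoc, hc, reassoc_of% h₁]⟩
    exact imageSubobject_le _ sq.lift sq.fac_right

lemma isZero_coinvariants_of_commutator_eq (h : ξ.commutator = imageSubobject ξ.inM) :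
    IsZero ξ.coinvariants := by
  obtain ⟨u, hu⟩ := ξ.exists_comp_commutatorToM (𝟙 M)
    (factorThruImageSubobject ξ.inM ≫ Subobject.ofLE _ _ h.ge) (by simp)
  have hk : ξ.commutatorToM ≫ ξ.toCoinvariants = 0 := cokernel.condition _
  have h₀ : ξ.toCoinvariants = 0 := by
    rw [← Category.id_comp ξ.toCoinvariants, ← hu, Category.assoc, hk, comp_zero]
  rw [IsZero.iff_id_eq_zero, ← cancel_epi ξ.toCoinvariants, h₀, zero_comp, zero_comp]

end InternalAction

/-! ### Crossed modules: reflection in abelian objects and perfectness -/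

lemma CrossedModuleOver.isAbelianObject_coinvariants {L : C} (X : CrossedModuleOver L) :
    IsAbelianObject X.action.coinvariants := by
  refine isAbelianObject_of_cosmashι_comp X.action.toCoinvariants ?_
  -- The Peiffer identity writes conjugation as the action of `L` restricted along `∂`, and the
  -- action of `L` becomes trivial on the quotient.
  have h : conj X.M ≫ X.action.toCoinvariants =
      (trivialAction X.M X.M).act ≫ X.action.toCoinvariants := by
    rw [← X.peiffer, Category.assoc, X.action.act_toCoinvariants, ← Category.assoc,
      trivialAction_natural, Category.comp_id]
  have e : coprod.desc X.action.toCoinvariants X.action.toCoinvariants =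
      coprod.desc (𝟙 X.M) (𝟙 X.M) ≫ X.action.toCoinvariants := by ext <;> simp
  have := cosmashToFlat X.M X.M ≫= h
  rw [conj] at this
  rw [e, ← cosmashToFlat_ι]
  simp only [Category.assoc] at this ⊢
  rw [this, ← Category.assoc, cosmashToFlat_trivialAction, zero_comp]

/-- The quotient `M ⟶ M / [L, M]` as a morphism of crossed modules. -/
def CrossedModuleOver.unit {L : C} (X : CrossedModuleOver L) :
    X.toXMod ⟶ (abInclusion C).obj ⟨X.action.coinvariants, X.isAbelianObject_coinvariants⟩ where
  f := X.action.toCoinvariants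
  l := 0
  comm := (isZero_zero C).eq_of_tgt _ _
  equivariant := (trivialAction_natural _ _).trans X.action.act_toCoinvariants.symm

lemma CrossedModuleOver.isUniversal_unit {L : C} (X : CrossedModuleOver L) :
    Nonempty (StructuredArrow.mk X.unit).IsUniversal := by
  have hg (Y : StructuredArrow X.toXMod (abInclusion C)) :
      X.action.commutatorToM ≫ Y.hom.f = 0 := by
    refine (X.action.commutatorToM_comp_eq_zero_iff _).2 ((X.action.act_comp_eq_iff _).1 ?_)
    exact Y.hom.equivariant.symm.trans (trivialAction_natural _ _)
  refine ⟨IsInitial.ofUniqueHom (fun Y => StructuredArrow.homMk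
    (ObjectProperty.homMk (cokernel.desc _ _ (hg Y))) ?_) fun Y m => ?_⟩
  · apply XMod.Hom.ext
    · exact cokernel.π_desc _ _ _
    · exact (isZero_zero C).eq_of_tgt _ _
  · apply StructuredArrow.hom_ext
    apply ObjectProperty.hom_ext
    refine (cancel_epi X.action.toCoinvariants).1 ?_
    exact (congrArg XMod.Hom.f (StructuredArrow.w m)).trans (cokernel.π_desc _ _ (hg Y)).symm

lemma CrossedModuleOver.isPerfect_iff {L : C} (X : CrossedModuleOver L) :
    X.IsPerfect ↔ IsZero X.action.coinvariants :=
  ⟨X.action.isZero_coinvariants_of_commutator_eq, X.action.commutator_eq_of_isZero⟩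

end SemiAbelian

end

theorem mainTheorem4 {C : Type u} [Category.{v} C] [HasZeroMorphisms C] [SemiAbelian C]
    (hSH : SemiAbelian.SmithIsHuq C) (L : C) (X : SemiAbelian.CrossedModuleOver L) :
    -- the reflection of `X` in `Ab` is the quotient `M ⟶ M / [L, M]`
    (∃ (hA : SemiAbelian.IsAbelianObject X.action.coinvariants)
      (η : X.toXMod ⟶ (SemiAbelian.abInclusion C).obj ⟨X.action.coinvariants, hA⟩),
      η.f = X.action.toCoinvariants ∧ Nonempty (StructuredArrow.mk η).IsUniversal) ∧
    (X.IsPerfect ↔ IsPerfectWithRespectTo (SemiAbelian.abInclusion C) X.toXMod) := by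
  obtain ⟨hU⟩ := X.isUniversal_unit
  refine ⟨⟨X.isAbelianObject_coinvariants, X.unit, rfl, ⟨hU⟩⟩, ?_⟩
  rw [X.isPerfect_iff]
  refine ⟨fun h => ⟨_, X.unit, ⟨hU⟩, (IsZero.iff_id_eq_zero _).2 ?_⟩, ?_⟩
  · exact ObjectProperty.hom_ext _ (h.eq_of_src _ _)
  · rintro ⟨Y, η, ⟨hη⟩, hY⟩
    -- Universal arrows are unique up to isomorphism, so any zero reflection forces the coinvariants
    -- to be zero in `Ab`, and then in `C`.
    have h := hY.of_iso ((StructuredArrow.proj _ _).mapIso (hU.uniqueUpToIso hη))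
    let Q : SemiAbelian.AbObj C := ⟨X.action.coinvariants, X.isAbelianObject_coinvariants⟩
    have h₀ : 𝟙 Q = ObjectProperty.homMk 0 := h.eq_of_src _ _
    exact (IsZero.iff_id_eq_zero _).2 (congrArg (fun f : Q ⟶ Q => f.hom) h₀)
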